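/- Let $(\Omega,\mathcal F,\mu)$ be a complete probability space with an increasing sequence $(\mathcal F_n)_{n\ge 0}$ of sub-$\sigma$-fields of $\mathcal F$ such that $\mathcal F=\bigvee_{n\ge0}\mathcal F_n$; write $E_n=E(\cdot\mid\mathcal F_n)$, and let $\mathcal T$ be the family of all stopping times $\tau:\Omega\to\{0,1,2,\dots\}\cup\{\infty\}$. An infinite product is the limit of its partial products, and for nonnegative factors "$\prod_i c_i<\infty$" means that this limit exists and is finite (it may be $0$). A weight is an integrable random variable that is positive almost everywhere; for a weight $w$ and $0<q<\infty$, $\|f\|_{L^q(w)}=(\int_\Omega|f|^q w\,d\mu)^{1/q}$, and $|B|_w=\int_B w\,d\mu$. For a sequence $\vec f=(f_1,f_2,\dots)$ of real functions let $$\mathfrak M(\vec f)=\sup_{n\ge0}\prod_{i=1}^\infty|E_n(f_i)|.$$ Let $1<p_i<\infty$ for $i\ge 1$ and $0<p<\infty$ with $\sum_{i=1}^\infty\frac1{p_i}=\frac1p$, and let $\frac1{p_i}+\frac1{p_i'}=1$. Let $v$ and $\omega_1,\omega_2,\dots$ be weights, put $\sigma_i=\omega_i^{-1/(p_i-1)}$,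 and assume that every $\sigma_i$ is integrable, that $\prod_{i}\|\sigma_i\|_{L^{p_i}(\omega_i)}<\infty$, that for every $n$, $\prod_{i}E_n(\sigma_i)^{1/p_i'}<\infty$ almost everywhere, and that $\prod_{i}\sigma_i^{1/p_i}>0$ almost everywhere. Assume also that $\vec\omega\in RH_{\vec p}$, that is, there is a constant $C>0$ such that for all $\tau\in\mathcal T$ $$\prod_{i=1}^\infty\Big(\int_{\{\tau<\infty\}}\sigma_i\,d\mu\Big)^{p/p_i}\le C\int_{\{\tau<\infty\}}\prod_{i=1}^\infty\sigma_i^{p/p_i}\,d\mu .$$ Then the following three statements are equivalent. 1. There is a constant $C>0$ such that $\|\mathfrak M(\vec f)\|_{L^p(v)}\le C\prod_{i=1}^\infty\|f_i\|_{L^{p_i}(\omega_i)}$ for all $f_i\in L^{p_i}(\omega_i)$, $i\ge1$, with $\prod_{i}\|f_i\|_{L^{p_i}(\omega_i)}<\infty$. 2. There is a constant $C>0$ such that $\|\mathfrak M(\overrightarrow{g\sigma})\|_{L^p(v)}\le C\prod_{i=1}^\infty\|g_i\|_{L^{p_i}(\sigma_i)}$ for all $g_i\in L^{p_i}(\sigma_i)$,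 $i\ge1$, with $\prod_{i}\|g_i\|_{L^{p_i}(\sigma_i)}<\infty$, where $\overrightarrow{g\sigma}=(g_1\sigma_1,g_2\sigma_2,\dots)$. 3. $(v,\vec\omega)\in S_{\vec p}$, that is, there is a constant $C>0$ such that for all $\tau\in\mathcal T$ $$\Big(\int_{\{\tau<\infty\}}\mathfrak M\big(\sigma_1\chi_{\{\tau<\infty\}},\sigma_2\chi_{\{\tau<\infty\}},\dots\big)^p\,v\,d\mu\Big)^{1/p}\le C\prod_{i=1}^\infty|\{\tau<\infty\}|_{\sigma_i}^{1/p_i}.$$ -/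

import Mathlib

open MeasureTheory Filter Topology
open scoped ENNReal NNReal

noncomputable section

namespace GenDoob

/-- The infinite product `∏ c i` converges to a finite limit (possibly `0`): the sequence of partial
products `∏_{i<k} c i` converges to a finite number. -/
def ProdConverges (c : ℕ → ℝ≥0∞) : Prop :=
  ∃ L : ℝ≥0∞, L ≠ ∞ ∧ Tendsto (fun k => ∏ i ∈ Finset.range k, c i) atTop (𝓝 L)

/-- The value of the infinite product `∏ c i`, as the limit of its partial products. (Written as an
upper limit so that it is total; it is the limit whenever the limit exists, see
`infProd_eq_of_tendsto`.) -/
def infProd (c : ℕ → ℝ≥0∞) : ℝ≥0∞ :=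
  limsup (fun k => ∏ i ∈ Finset.range k, c i) atTop

theorem infProd_eq_of_tendsto {c : ℕ → ℝ≥0∞} {L : ℝ≥0∞}
    (h : Tendsto (fun k => ∏ i ∈ Finset.range k, c i) atTop (𝓝 L)) : infProd c = L :=
  h.limsup_eq

variable {Ω : Type*} {mΩ : MeasurableSpace Ω}

/-- A weight: an integrable, almost everywhere positive random variable. -/
def IsWeight (μ : Measure Ω) (w : Ω → ℝ) : Prop :=
  Integrable w μ ∧ ∀ᵐ x ∂μ, 0 < w x

/-- The measure `w dμ`. -/
def wMeasure (μ : Measure Ω) (w : Ω → ℝ) : Measure Ω :=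
  μ.withDensity (fun x => ENNReal.ofReal (w x))

/-- The norm `‖f‖_{L^q(w)} = (∫ |f|^q w dμ)^{1/q}` of a real function. -/
def wNorm (μ : Measure Ω) (q : ℝ) (w f : Ω → ℝ) : ℝ≥0∞ :=
  eLpNorm f (ENNReal.ofReal q) (wMeasure μ w)

/-- `f ∈ L^q(w)`. -/
def MemWLp (μ : Measure Ω) (q : ℝ) (w f : Ω → ℝ) : Prop :=
  MemLp f (ENNReal.ofReal q) (wMeasure μ w)

/-- The dual weights `σ_i = ω_i^{-1/(p_i - 1)}`. -/
def dualWeight (p : ℕ → ℝ) (ω : ℕ → Ω → ℝ) (i : ℕ) (x : Ω) : ℝ :=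
  ω i x ^ (-(1 / (p i - 1)))

/-- The generalized Doob maximal operator `𝔐(f) = sup_n ∏_i |E(f_i | ℱ_n)|`. -/
def maximal (μ : Measure Ω) (ℱ : Filtration ℕ mΩ) (f : ℕ → Ω → ℝ) (x : Ω) : ℝ≥0∞ :=
  ⨆ n, infProd (fun i => ‖(μ[f i | ℱ n]) x‖ₑ)

/-- The set `{τ < ∞}`. -/
def finiteSet (τ : Ω → WithTop ℕ) : Set Ω := {x | τ x < ⊤}

/-- `|B|_w = ∫_B w dμ`. -/
def wMass (μ : Measure Ω) (w : Ω → ℝ) (B : Set Ω) : ℝ≥0∞ :=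
  ∫⁻ x in B, ENNReal.ofReal (w x) ∂μ

/-- The reverse Hölder condition `ω ∈ RH_p`. -/
def ReverseHolder (μ : Measure Ω) (ℱ : Filtration ℕ mΩ) (p : ℕ → ℝ) (p₀ : ℝ)
    (ω : ℕ → Ω → ℝ) : Prop :=
  ∃ C : ℝ≥0, 0 < C ∧ ∀ τ : Ω → WithTop ℕ, IsStoppingTime ℱ τ →
    infProd (fun i => wMass μ (dualWeight p ω i) (finiteSet τ) ^ (p₀ / p i)) ≤
      C * ∫⁻ x in finiteSet τ,
        infProd (fun i => ENNReal.ofReal (dualWeight p ω i x) ^ (p₀ / p i)) ∂μ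

/-- The Sawyer-type testing condition `(v, ω) ∈ S_p`. -/
def SawyerCondition (μ : Measure Ω) (ℱ : Filtration ℕ mΩ) (p : ℕ → ℝ) (p₀ : ℝ)
    (v : Ω → ℝ) (ω : ℕ → Ω → ℝ) : Prop :=
  ∃ C : ℝ≥0, 0 < C ∧ ∀ τ : Ω → WithTop ℕ, IsStoppingTime ℱ τ →
    (∫⁻ x in finiteSet τ,
        maximal μ ℱ (fun i => (finiteSet τ).indicator (dualWeight p ω i)) x ^ p₀
          * ENNReal.ofReal (v x) ∂μ) ^ (1 / p₀) ≤
      C * infProd (fun i => wMass μ (dualWeight p ω i) (finiteSet τ) ^ (1 / p i))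

/-- `‖𝔐(f)‖_{L^{p₀}(v)} ≤ C ∏ ‖f_i‖_{L^{p_i}(ω_i)}` for all `f_i ∈ L^{p_i}(ω_i)` with
`∏ ‖f_i‖_{L^{p_i}(ω_i)} < ∞`. -/
def StrongType (μ : Measure Ω) (ℱ : Filtration ℕ mΩ) (p : ℕ → ℝ) (p₀ : ℝ)
    (v : Ω → ℝ) (ω : ℕ → Ω → ℝ) : Prop :=
  ∃ C : ℝ≥0, 0 < C ∧ ∀ f : ℕ → Ω → ℝ, (∀ i, MemWLp μ (p i) (ω i) (f i)) →
    ProdConverges (fun i => wNorm μ (p i) (ω i) (f i)) →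
    eLpNorm (maximal μ ℱ f) (ENNReal.ofReal p₀) (wMeasure μ v) ≤
      C * infProd (fun i => wNorm μ (p i) (ω i) (f i))

/-- `‖𝔐(gσ)‖_{L^{p₀}(v)} ≤ C ∏ ‖g_i‖_{L^{p_i}(σ_i)}` for all `g_i ∈ L^{p_i}(σ_i)` with
`∏ ‖g_i‖_{L^{p_i}(σ_i)} < ∞`, where `gσ = (g_1 σ_1, g_2 σ_2, …)`. -/
def DualStrongType (μ : Measure Ω) (ℱ : Filtration ℕ mΩ) (p : ℕ → ℝ) (p₀ : ℝ)
    (v : Ω → ℝ) (ω : ℕ → Ω → ℝ) : Prop :=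
  ∃ C : ℝ≥0, 0 < C ∧ ∀ g : ℕ → Ω → ℝ, (∀ i, MemWLp μ (p i) (dualWeight p ω i) (g i)) →
    ProdConverges (fun i => wNorm μ (p i) (dualWeight p ω i) (g i)) →
    eLpNorm (maximal μ ℱ (fun i x => g i x * dualWeight p ω i x)) (ENNReal.ofReal p₀)
        (wMeasure μ v) ≤
      C * infProd (fun i => wNorm μ (p i) (dualWeight p ω i) (g i))

end GenDoob

end

/-! ### Infinite products in `[0, ∞]` -/

namespace GenDoob

/-! Since `ω_i σ_i^{p_i} = σ_i`, the substitution `f_i = g_i σ_i` is a norm-preserving bijection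
from `L^{p_i}(σ_i)` to `L^{p_i}(ω_i)`, so the two strong-type statements are one. Taking every `g_i`
to be the indicator of `{τ < ∞}` gives the testing condition.

For the converse, write `E_n(g_i σ_i) = E_n^{σ_i}(g_i) E_n(σ_i)` (`condExp_mul_weight`), where
`E_n^{σ_i}` is conditional expectation for `σ_i dμ`, and put `h_n = ∏ E_n^{σ_i}(|g_i|)` and `H =
sup_n h_n`. Let `τ_k` be the first time that `h_n > 2^k`, so that `{τ_k < ∞} = {H > 2^k}`. Where
`2^k < h_n ≤ 2^{k+1}`, the product `h_n ∏ E_n(σ_i)` is at most `2^{k+1}` times the maximal function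
of the `σ_i` cut off to `{τ_k < ∞}`. Testing and then the reverse Hölder condition bound the
integral of the `p`-th power of that function against `v` by a multiple of `∫_{H > 2^k} ∏
σ_i^{p/p_i}`. Summing over `k` is geometric (`exists_tsum_zpow_lt_le`) and leaves `∫ H^p ∏
σ_i^{p/p_i}`.

This is controlled in `lintegral_iSup_weightedCondProd_le` by Doob's inequality for each `σ_i dμ`
and Hölder's inequality for countably many factors. The Doob constants multiply to `∏ p_i'`, finite
because `∑ 1/p_i` converges. The remaining difficulty is the convergence of infinite products and
the avoidance of `0 · ∞`. -/

theorem ProdConverges.tendsto {c : ℕ → ℝ≥0∞} (h : ProdConverges c) :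
    Tendsto (fun k => ∏ i ∈ Finset.range k, c i) atTop (𝓝 (infProd c)) := by
  obtain ⟨L, -, hL⟩ := h
  rwa [infProd_eq_of_tendsto hL]

theorem ProdConverges.infProd_ne_top {c : ℕ → ℝ≥0∞} (h : ProdConverges c) : infProd c ≠ ∞ := by
  obtain ⟨L, hL', hL⟩ := h
  rwa [infProd_eq_of_tendsto hL]

theorem ProdConverges.tendsto_mul {c d : ℕ → ℝ≥0∞} (hc : ProdConverges c) (hd : ProdConverges d) :
    Tendsto (fun k => ∏ i ∈ Finset.range k, c i * d i) atTop (𝓝 (infProd c * infProd d)) := by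
  simp_rw [Finset.prod_mul_distrib]
  exact ENNReal.Tendsto.mul hc.tendsto (Or.inr hd.infProd_ne_top) hd.tendsto
    (Or.inr hc.infProd_ne_top)

theorem ProdConverges.mul {c d : ℕ → ℝ≥0∞} (hc : ProdConverges c) (hd : ProdConverges d) :
    ProdConverges (fun i => c i * d i) :=
  ⟨_, ENNReal.mul_ne_top hc.infProd_ne_top hd.infProd_ne_top, hc.tendsto_mul hd⟩

theorem ProdConverges.infProd_mul {c d : ℕ → ℝ≥0∞} (hc : ProdConverges c) (hd : ProdConverges d) :
    infProd (fun i => c i * d i) = infProd c * infProd d :=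
  infProd_eq_of_tendsto (hc.tendsto_mul hd)

theorem infProd_mono {c d : ℕ → ℝ≥0∞} (h : ∀ i, c i ≤ d i) : infProd c ≤ infProd d :=
  limsup_le_limsup (Eventually.of_forall fun _ => Finset.prod_le_prod' fun i _ => h i)

/-- `x ↦ x ^ r` is an order isomorphism of `[0, ∞]`, so it commutes with upper limits; no
convergence is needed. -/
theorem infProd_rpow (c : ℕ → ℝ≥0∞) {r : ℝ} (hr : 0 < r) :
    infProd (fun i => c i ^ r) = infProd c ^ r := by
  have h := (ENNReal.orderIsoRpow r hr).limsup_apply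
    (u := fun k => ∏ i ∈ Finset.range k, c i) (f := atTop)
  simp only [ENNReal.orderIsoRpow_apply] at h
  rw [infProd, infProd, h]
  congr 1
  ext k
  exact ENNReal.prod_rpow_of_nonneg hr.le

theorem ProdConverges.of_eq_zero {c : ℕ → ℝ≥0∞} {i : ℕ} (hi : c i = 0) : ProdConverges c := by
  refine ⟨0, ENNReal.zero_ne_top, tendsto_const_nhds.congr' ?_⟩
  filter_upwards [eventually_gt_atTop i] with k hk
  exact (Finset.prod_eq_zero (Finset.mem_range.2 hk) hi).symm

/-- A product of nonnegative factors dominated factorwise by a convergent product of positive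
factors converges. -/
theorem ProdConverges.of_le {u c : ℕ → ℝ≥0∞} (hc : ProdConverges c) (h : ∀ i, u i ≤ c i)
    (hc0 : ∀ i, c i ≠ 0) (hct : ∀ i, c i ≠ ∞) : ProdConverges u := by
  -- The ratios `u i / c i` are at most `1`, so their partial products decrease and converge;
  -- multiplying by the convergent product of the `c i` recovers `u`.
  have hle : ∀ i, u i / c i ≤ 1 := fun i => ENNReal.div_le_of_le_mul (by simpa using h i)
  have hr : ProdConverges (fun i => u i / c i) := by
    have hanti : Antitone (fun k => ∏ i ∈ Finset.range k, u i / c i) :=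
      antitone_nat_of_succ_le fun k => by
        rw [Finset.prod_range_succ]
        exact mul_le_of_le_one_right' (hle k)
    refine ⟨_, ne_top_of_le_ne_top ENNReal.one_ne_top ?_, tendsto_atTop_iInf hanti⟩
    exact (iInf_le _ 0).trans (by simp)
  convert hr.mul hc using 2 with i
  exact (ENNReal.div_mul_cancel (hc0 i) (hct i)).symm

/-- The partial products increase and `1 + e ≤ exp e` bounds them by `exp (∑ e i)`. -/
theorem prodConverges_one_add {e : ℕ → ℝ≥0∞} (he : ∑' i, e i ≠ ∞) :
    ProdConverges (fun i => 1 + e i) := by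
  have het : ∀ i, e i ≠ ∞ := ENNReal.ne_top_of_tsum_ne_top he
  have hmono : Monotone (fun k => ∏ i ∈ Finset.range k, (1 + e i)) :=
    monotone_nat_of_le_succ fun k => by
      rw [Finset.prod_range_succ]
      exact le_mul_of_one_le_right' le_self_add
  refine ⟨_, ne_top_of_le_ne_top (ENNReal.ofReal_ne_top (r := Real.exp (∑' i, e i).toReal)) ?_,
    tendsto_atTop_iSup hmono⟩
  refine iSup_le fun k => ?_
  calc ∏ i ∈ Finset.range k, (1 + e i)
      ≤ ∏ i ∈ Finset.range k, ENNReal.ofReal (Real.exp (e i).toReal) := by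
        refine Finset.prod_le_prod' fun i _ => ?_
        rw [← ENNReal.toReal_le_toReal (by simp [het i]) ENNReal.ofReal_ne_top,
          ENNReal.toReal_ofReal (Real.exp_nonneg _), ENNReal.toReal_add ENNReal.one_ne_top (het i),
          ENNReal.toReal_one, add_comm]
        exact Real.add_one_le_exp _
    _ = ENNReal.ofReal (Real.exp (∑ i ∈ Finset.range k, e i).toReal) := by
        rw [← ENNReal.ofReal_prod_of_nonneg fun i _ => Real.exp_nonneg _, ← Real.exp_sum,
          ENNReal.toReal_sum fun i _ => het i]
    _ ≤ _ := by
        gcongr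
        exact ENNReal.sum_le_tsum _

/-- Bernoulli's inequality; it turns convergence of a product of powers into summability. -/
theorem rpow_le_one_add_mul (y : ℝ≥0∞) {a : ℝ} (ha0 : 0 < a) (ha1 : a ≤ 1) :
    y ^ a ≤ 1 + ENNReal.ofReal a * y := by
  induction y with
  | top => simp [ENNReal.mul_top, ha0]
  | coe y =>
    rw [← ENNReal.coe_rpow_of_nonneg _ ha0.le, ENNReal.ofReal, ← ENNReal.coe_mul,
      ← ENNReal.coe_one, ← ENNReal.coe_add, ENNReal.coe_le_coe, ← NNReal.coe_le_coe]
    push_cast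
    rw [Real.coe_toNNReal _ ha0.le]
    have h := rpow_one_add_le_one_add_mul_self (s := y - 1) (by linarith [y.coe_nonneg])
      ha0.le ha1
    rw [add_sub_cancel] at h
    nlinarith

theorem prodConverges_rpow {y : ℕ → ℝ≥0∞} {a : ℕ → ℝ} (ha0 : ∀ i, 0 < a i) (ha1 : ∀ i, a i ≤ 1)
    (h : ∑' i, ENNReal.ofReal (a i) * y i ≠ ∞) : ProdConverges (fun i => y i ^ a i) :=
  (prodConverges_one_add h).of_le (fun i => rpow_le_one_add_mul (y i) (ha0 i) (ha1 i))
    (fun _ => (zero_lt_one.trans_le le_self_add).ne')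
    (fun i => ENNReal.add_ne_top.2 ⟨ENNReal.one_ne_top, ENNReal.ne_top_of_tsum_ne_top h i⟩)

/-! ### Almost everywhere convergence and Hölder's inequality for infinite products -/

variable {Ω : Type*} {mΩ : MeasurableSpace Ω}

/-- After normalising, `∑ a_i Y_i / N_i` has integral at most `∑ a_i < ∞`, hence is finite almost
everywhere. By Bernoulli's inequality `∏ (Y_i / N_i) ^ a_i` then converges, and the factor `∏ N_i ^
a_i` is restored. If some `N_i` vanishes, so does `Y_i` almost everywhere. -/
theorem ae_prodConverges_rpow {μ : Measure Ω} {Y : ℕ → Ω → ℝ≥0∞} {N : ℕ → ℝ≥0∞} {a : ℕ → ℝ}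
    (hY : ∀ i, AEMeasurable (Y i) μ) (hYN : ∀ i, ∫⁻ x, Y i x ∂μ ≤ N i) (hN : ∀ i, N i ≠ ∞)
    (ha0 : ∀ i, 0 < a i) (ha1 : ∀ i, a i ≤ 1) (ha : Summable a)
    (hprod : ProdConverges (fun i => N i ^ a i)) :
    ∀ᵐ x ∂μ, ProdConverges (fun i => Y i x ^ a i) := by
  by_cases h0 : ∃ i, N i = 0
  · obtain ⟨i, hi⟩ := h0
    have := (lintegral_eq_zero_iff' (hY i)).1 (le_antisymm (hi ▸ hYN i) zero_le)
    filter_upwards [this] with x hx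
    exact ProdConverges.of_eq_zero (i := i) (by simp [hx, ha0 i])
  push Not at h0
  have hfin : ∫⁻ x, ∑' i, ENNReal.ofReal (a i) * (Y i x / N i) ∂μ ≠ ∞ := by
    rw [lintegral_tsum fun i => ((hY i).div_const _).const_mul _]
    refine ne_top_of_le_ne_top ha.tsum_ofReal_ne_top (ENNReal.tsum_le_tsum fun i => ?_)
    rw [lintegral_const_mul'' _ ((hY i).div_const _)]
    simp_rw [div_eq_mul_inv]
    rw [lintegral_mul_const'' _ (hY i), ← div_eq_mul_inv]
    exact mul_le_of_le_one_right' (ENNReal.div_le_of_le_mul (by simpa using hYN i))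
  have hae := ae_lt_top' (AEMeasurable.tsum fun i => ((hY i).div_const _).const_mul _) hfin
  filter_upwards [hae] with x hx
  convert (prodConverges_rpow ha0 ha1 hx.ne).mul hprod using 2 with i
  rw [← ENNReal.mul_rpow_of_nonneg _ _ (ha0 i).le, ENNReal.div_mul_cancel (h0 i) (hN i)]

/-- Hölder's inequality for finitely many functions and exponents of total mass at most one, on a
probability space. -/
theorem lintegral_prod_rpow_le_of_sum_le_one {μ : Measure Ω} [IsProbabilityMeasure μ]
    {Y : ℕ → Ω → ℝ≥0∞} {a : ℕ → ℝ} (s : Finset ℕ) (hY : ∀ i, AEMeasurable (Y i) μ)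
    (ha0 : ∀ i, 0 ≤ a i) (ha : ∑ i ∈ s, a i ≤ 1) :
    ∫⁻ x, ∏ i ∈ s, Y i x ^ a i ∂μ ≤ ∏ i ∈ s, (∫⁻ x, Y i x ∂μ) ^ a i := by
  -- The missing exponent `1 - ∑ a i` is given to the constant function `1`, placed at the extra
  -- index `none`.
  have h := ENNReal.lintegral_prod_norm_pow_le (μ := μ) (s.insertNone)
    (f := fun o => o.elim (fun _ => 1) Y)
    (p := fun o => o.elim (1 - ∑ i ∈ s, a i) a)
    (by rintro (_ | i) _; exacts [aemeasurable_const, hY i])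
    (by simp)
    (by rintro (_ | i) _; exacts [sub_nonneg.2 ha, ha0 i])
  simpa [Finset.prod_insertNone] using h

/-- Hölder's inequality for countably many functions. -/
theorem lintegral_infProd_rpow_le {μ : Measure Ω} [IsProbabilityMeasure μ]
    {Y : ℕ → Ω → ℝ≥0∞} {N : ℕ → ℝ≥0∞} {a : ℕ → ℝ} {r : ℝ} (hr : 0 < r)
    (hY : ∀ i, AEMeasurable (Y i) μ) (hYN : ∀ i, ∫⁻ x, Y i x ∂μ ≤ N i)
    (ha0 : ∀ i, 0 < a i) (ha : HasSum a (1 / r))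
    (hconv : ∀ᵐ x ∂μ, ProdConverges (fun i => Y i x ^ a i)) :
    ∫⁻ x, infProd (fun i => Y i x ^ a i) ^ r ∂μ ≤ infProd (fun i => N i ^ a i) ^ r := by
  -- Pointwise convergence replaces the upper limit by a lower one, so that Fatou's lemma reduces
  -- the claim to finite products, with exponents `a i * r` of total at most `1`.
  have hpt : ∀ᵐ x ∂μ, infProd (fun i => Y i x ^ a i) ^ r =
      liminf (fun k => ∏ i ∈ Finset.range k, Y i x ^ (a i * r)) atTop := by
    filter_upwards [hconv] with x hx
    refine (Tendsto.liminf_eq ?_).symm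
    have := (ENNReal.continuous_rpow_const (y := r)).tendsto _ |>.comp hx.tendsto
    refine this.congr fun k => ?_
    simp only [Function.comp, ENNReal.rpow_mul]
    exact (ENNReal.prod_rpow_of_nonneg hr.le).symm
  rw [lintegral_congr_ae hpt, ← infProd_rpow _ hr]
  refine (lintegral_liminf_le' fun k => Finset.aemeasurable_fun_prod _ fun i _ =>
    (hY i).pow_const _).trans ?_
  refine le_trans (liminf_le_liminf (Eventually.of_forall fun k => ?_)) liminf_le_limsup
  refine (lintegral_prod_rpow_le_of_sum_le_one (Finset.range k) hY
    (fun i => (mul_pos (ha0 i) hr).le) ?_).trans (Finset.prod_le_prod' fun i _ => ?_)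
  · rw [← Finset.sum_mul, ← le_div_iff₀ hr]
    exact sum_le_hasSum _ (fun i _ => (ha0 i).le) ha
  · rw [ENNReal.rpow_mul]
    have := (ha0 i).le
    gcongr
    exact hYN i

/-! ### Doob's inequality for a finite measure -/

/-- A weak-type estimate with the integral of `X` over the level sets implies a strong-type one. -/
theorem lintegral_rpow_le_of_weak_type_of_bounded {ν : Measure Ω} [IsFiniteMeasure ν] {Y : Ω → ℝ}
    {X : Ω → ℝ≥0∞} (hY0 : 0 ≤ Y) (hY : Measurable Y) (hX : AEMeasurable X ν) {R : ℝ}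
    (hR : ∀ x, Y x ≤ R)
    (hweak : ∀ t : ℝ, 0 < t → ENNReal.ofReal t * ν {x | t ≤ Y x} ≤ ∫⁻ x in {x | t ≤ Y x}, X x ∂ν)
    {q : ℝ} (hq : 1 < q) :
    ∫⁻ x, ENNReal.ofReal (Y x) ^ q ∂ν ≤
      ENNReal.ofReal (q / (q - 1)) ^ q * ∫⁻ x, X x ^ q ∂ν := by
  have hq0 : 0 < q := by linarith
  have hq1 : 0 < q - 1 := by linarith
  have hconj : q.HolderConjugate q.conjExponent := Real.HolderConjugate.conjExponent hq
  set I := ∫⁻ x, ENNReal.ofReal (Y x) ^ q ∂ν with hI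
  -- The layer-cake formula is used twice: for `Y ^ q` under `ν` and for `Y ^ (q - 1)` under `X dν`.
  -- Integrating the weak-type bound against `t ^ (q - 2)` compares the two, and the ratio of their
  -- prefactors is `q / (q - 1)`.
  have hlevel : ∫⁻ x, ENNReal.ofReal (Y x ^ q) ∂ν ≤
      ENNReal.ofReal (q / (q - 1)) * ∫⁻ x, X x * ENNReal.ofReal (Y x ^ (q - 1)) ∂ν := by
    have h1 := lintegral_rpow_eq_lintegral_meas_le_mul ν (Eventually.of_forall hY0)
      hY.aemeasurable hq0
    have h2 := lintegral_rpow_eq_lintegral_meas_le_mul (ν.withDensity X) (Eventually.of_forall hY0)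
      hY.aemeasurable hq1
    rw [lintegral_withDensity_eq_lintegral_mul₀ hX (by fun_prop)] at h2
    simp only [Pi.mul_apply] at h2
    rw [h2, h1, ← mul_assoc, ← ENNReal.ofReal_mul (by positivity), div_mul_cancel₀ _ hq1.ne']
    gcongr 1
    refine setLIntegral_mono' measurableSet_Ioi fun t ht => ?_
    have ht : 0 < t := ht
    rw [withDensity_apply _ (measurableSet_le measurable_const hY)]
    calc ν {x | t ≤ Y x} * ENNReal.ofReal (t ^ (q - 1))
        = ENNReal.ofReal t * ν {x | t ≤ Y x} * ENNReal.ofReal (t ^ (q - 1 - 1)) := by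
          rw [Real.rpow_sub_one ht.ne' (q - 1), mul_comm (ENNReal.ofReal t), mul_assoc,
            ← ENNReal.ofReal_mul ht.le, mul_div_cancel₀ _ ht.ne']
      _ ≤ _ := by gcongr; exact hweak t ht
  simp_rw [← ENNReal.ofReal_rpow_of_nonneg (hY0 _) hq0.le,
    ← ENNReal.ofReal_rpow_of_nonneg (hY0 _) hq1.le] at hlevel
  have hholder := ENNReal.lintegral_mul_le_Lp_mul_Lq ν hconj hX
    (g := fun x => ENNReal.ofReal (Y x) ^ (q - 1)) (by fun_prop)
  have hexp : (q - 1) * q.conjExponent = q := by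
    rw [Real.conjExponent]; field_simp
  simp_rw [← ENNReal.rpow_mul, hexp] at hholder
  have hmain := hlevel.trans (mul_le_mul_right hholder _)
  rw [← hI, ← mul_assoc] at hmain
  -- Boundedness of `Y` is needed only here: a finite `I` lets the factor `I ^ (1 / q')` from
  -- Hölder's inequality be cancelled.
  have hItop : I ≠ ∞ := by
    refine ne_top_of_le_ne_top (b := ∫⁻ _, ENNReal.ofReal R ^ q ∂ν) ?_
      (lintegral_mono fun x => by gcongr; exact hR x)
    rw [lintegral_const]
    exact ENNReal.mul_ne_top (ENNReal.rpow_ne_top_of_nonneg hq0.le ENNReal.ofReal_ne_top)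
      (measure_ne_top _ _)
  rcases eq_or_ne I 0 with h0 | h0
  · rw [h0]; exact zero_le
  have hsplit : I = I ^ (1 / q) * I ^ (1 / q.conjExponent) := by
    rw [← ENNReal.rpow_add _ _ h0 hItop]
    simp [hconj.inv_add_inv_eq_one]
  have hpos : 0 < 1 / q.conjExponent := one_div_pos.2 hconj.symm.pos
  have hcancel : I ^ (1 / q) ≤ ENNReal.ofReal (q / (q - 1)) * (∫⁻ x, X x ^ q ∂ν) ^ (1 / q) := by
    refine (ENNReal.mul_le_mul_iff_left (c := I ^ (1 / q.conjExponent)) ?_ ?_).1 ?_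
    · simp [h0, hItop]
    · exact ENNReal.rpow_ne_top_of_nonneg hpos.le hItop
    · rwa [← hsplit]
  calc I = (I ^ (1 / q)) ^ q := by rw [← ENNReal.rpow_mul, one_div_mul_cancel hq0.ne',
        ENNReal.rpow_one]
    _ ≤ (ENNReal.ofReal (q / (q - 1)) * (∫⁻ x, X x ^ q ∂ν) ^ (1 / q)) ^ q := by gcongr
    _ = _ := by
      rw [ENNReal.mul_rpow_of_nonneg _ _ hq0.le, ← ENNReal.rpow_mul, one_div_mul_cancel hq0.ne',
        ENNReal.rpow_one]

/-- Truncation at height `n` preserves the hypothesis, since level sets at `t ≤ n` are unchanged and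
those at `t > n` are empty; monotone convergence removes the truncation. -/
theorem lintegral_rpow_le_of_weak_type {ν : Measure Ω} [IsFiniteMeasure ν] {Y : Ω → ℝ}
    {X : Ω → ℝ≥0∞} (hY0 : 0 ≤ Y) (hY : Measurable Y) (hX : AEMeasurable X ν)
    (hweak : ∀ t : ℝ, 0 < t → ENNReal.ofReal t * ν {x | t ≤ Y x} ≤ ∫⁻ x in {x | t ≤ Y x}, X x ∂ν)
    {q : ℝ} (hq : 1 < q) :
    ∫⁻ x, ENNReal.ofReal (Y x) ^ q ∂ν ≤
      ENNReal.ofReal (q / (q - 1)) ^ q * ∫⁻ x, X x ^ q ∂ν := by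
  have hq0 : 0 < q := by linarith
  have hlim : ∀ x, ENNReal.ofReal (Y x) ^ q = ⨆ n : ℕ, ENNReal.ofReal (min (Y x) n) ^ q := by
    intro x
    obtain ⟨n, hn⟩ := exists_nat_ge (Y x)
    refine le_antisymm (le_iSup_of_le n (by rw [min_eq_left hn])) (iSup_le fun n => ?_)
    gcongr
    exact min_le_left _ _
  simp_rw [hlim]
  rw [lintegral_iSup (fun n => by fun_prop)
    (fun m n hmn x => by dsimp only; gcongr)]
  refine iSup_le fun n => lintegral_rpow_le_of_weak_type_of_bounded (R := n)
    (fun x => le_min (hY0 x) n.cast_nonneg) (hY.min measurable_const) hX (fun x => min_le_right _ _)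
    (fun t ht => ?_) hq
  by_cases htn : t ≤ n
  · simpa [htn] using hweak t ht
  · simp [htn]

/-- Doob's `L^q` inequality for the martingale `ν[g | ℱ n]`. -/
theorem lintegral_iSup_condExp_rpow_le {ν : Measure Ω} [IsFiniteMeasure ν] (ℱ : Filtration ℕ mΩ)
    {g : Ω → ℝ} (hg : Integrable g ν) (hg0 : 0 ≤ᵐ[ν] g) {q : ℝ} (hq : 1 < q) :
    ∫⁻ x, (⨆ n, ENNReal.ofReal ((ν[g | ℱ n]) x)) ^ q ∂ν ≤
      ENNReal.ofReal (q / (q - 1)) ^ q * ∫⁻ x, ENNReal.ofReal (g x) ^ q ∂ν := by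
  have hq0 : 0 < q := by linarith
  -- The positive part gives a submartingale nonnegative at every point, as `maximal_ineq` demands;
  -- `ENNReal.ofReal` does not see the change.
  set f : ℕ → Ω → ℝ := fun n => (ν[g | ℱ n])⁺ with hf
  have hsub : Submartingale f ℱ ν := (martingale_condExp g ℱ ν).submartingale.pos
  have hf0 : 0 ≤ f := fun n => posPart_nonneg _
  set Y : ℕ → Ω → ℝ := fun N x =>
    (Finset.range (N + 1)).sup' Finset.nonempty_range_add_one fun k => f k x with hYdef
  have hYF : ∀ N, Measurable[ℱ N] (Y N) := fun N =>
    @Finset.measurable_range_sup'' _ _ Ω (ℱ N) _ _ _ _ fun k hk =>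
      (hsub.stronglyMeasurable k).measurable.mono (ℱ.mono hk) le_rfl
  have hY : ∀ N, Measurable (Y N) := fun N => (hYF N).mono (ℱ.le N) le_rfl
  have hY0 : ∀ N, 0 ≤ Y N := fun N x =>
    (hf0 0 x).trans (Finset.le_sup' (fun k => f k x) (Finset.mem_range.2 N.succ_pos))
  have hlim : ∀ x, (⨆ n, ENNReal.ofReal ((ν[g | ℱ n]) x)) ^ q =
      ⨆ N, ENNReal.ofReal (Y N x) ^ q := by
    intro x
    have hiSup : (⨆ n, ENNReal.ofReal ((ν[g | ℱ n]) x)) = ⨆ N, ENNReal.ofReal (Y N x) := by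
      refine le_antisymm (iSup_mono fun n => ENNReal.ofReal_le_ofReal ?_) (iSup_le fun N => ?_)
      · exact (le_posPart ((ν[g | ℱ n]) x)).trans
          (Finset.le_sup' (fun k => f k x) (Finset.self_mem_range_succ n))
      · obtain ⟨k, -, hk⟩ := Finset.exists_mem_eq_sup' Finset.nonempty_range_add_one
          (s := Finset.range (N + 1)) fun k => f k x
        refine le_iSup_of_le k ?_
        rw [hYdef]
        dsimp only
        rw [hk]
        exact ENNReal.ofReal_le_ofReal_iff'.2 (by
          simp only [hf, posPart_def]
          rcases le_total ((ν[g | ℱ k]) x) 0 with h | h <;> simp [h])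
    rw [hiSup]
    exact (ENNReal.orderIsoRpow q hq0).map_iSup _
  simp_rw [hlim]
  rw [lintegral_iSup (fun n => by have := hY n; fun_prop) (fun m n hmn x => by
    dsimp only
    gcongr
    exact Finset.sup'_mono _ (Finset.range_subset_range.2 (by lia)) _)]
  refine iSup_le fun N => lintegral_rpow_le_of_weak_type (hY0 N) (hY N)
    hg.aemeasurable.ennreal_ofReal (fun t ht => ?_) hq
  have hA : MeasurableSet[ℱ N] {x | t ≤ Y N x} :=
    @measurableSet_le _ _ _ _ _ (ℱ N) _ _ _ _ _ (@measurable_const _ _ _ (ℱ N) _) (hYF N)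
  have hmax := maximal_ineq hsub hf0 (ε := ⟨t, ht.le⟩) N
  have hfN : f N =ᵐ[ν] ν[g | ℱ N] := by
    filter_upwards [condExp_nonneg (m := ℱ N) hg0] with x hx
    exact posPart_of_nonneg hx
  -- As the level set lies in `ℱ N`, the integral of `f N` over it, which the maximal inequality
  -- supplies, equals that of `g`.
  rw [← ofReal_integral_eq_lintegral_ofReal hg.integrableOn (ae_restrict_of_ae hg0),
    ← setIntegral_condExp (ℱ.le N) hg hA,
    ← setIntegral_congr_ae (ℱ.le N _ hA) (hfN.mono fun x hx _ => hx)]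
  rw [ENNReal.ofReal_eq_coe_nnreal ht.le]
  exact hmax

end GenDoob

/-! ### Weighted measures, dual weights and testing on indicators -/

namespace GenDoob

variable {Ω : Type*} {mΩ : MeasurableSpace Ω} {μ : Measure Ω} {w : Ω → ℝ}

theorem isFiniteMeasure_wMeasure (hw : Integrable w μ) : IsFiniteMeasure (wMeasure μ w) :=
  isFiniteMeasure_withDensity_ofReal hw.2

theorem wMeasure_absolutelyContinuous (μ : Measure Ω) (w : Ω → ℝ) : wMeasure μ w ≪ μ :=
  withDensity_absolutelyContinuous _ _

theorem IsWeight.absolutelyContinuous (hw : IsWeight μ w) : μ ≪ wMeasure μ w :=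
  withDensity_absolutelyContinuous' hw.1.aemeasurable.ennreal_ofReal
    (hw.2.mono fun _ hx => (ENNReal.ofReal_pos.2 hx).ne')

theorem lintegral_wMeasure (hw : Integrable w μ) (f : Ω → ℝ≥0∞) :
    ∫⁻ x, f x ∂wMeasure μ w = ∫⁻ x, ENNReal.ofReal (w x) * f x ∂μ :=
  lintegral_withDensity_eq_lintegral_mul_non_measurable₀ _ hw.aemeasurable.ennreal_ofReal
    (Eventually.of_forall fun _ => ENNReal.ofReal_lt_top) f

theorem integrable_wMeasure_iff (hw : IsWeight μ w) {g : Ω → ℝ} :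
    Integrable g (wMeasure μ w) ↔ Integrable (fun x => g x * w x) μ := by
  rw [wMeasure, integrable_withDensity_iff_integrable_smul₀' hw.1.aemeasurable.ennreal_ofReal
    (Eventually.of_forall fun _ => ENNReal.ofReal_lt_top)]
  refine integrable_congr (hw.2.mono fun x hx => ?_)
  simp [ENNReal.toReal_ofReal hx.le, mul_comm]

theorem setIntegral_wMeasure (hw : IsWeight μ w) (g : Ω → ℝ) {s : Set Ω} (hs : MeasurableSet s) :
    ∫ x in s, g x ∂wMeasure μ w = ∫ x in s, g x * w x ∂μ := by
  rw [wMeasure, setIntegral_withDensity_eq_setIntegral_toReal_smul₀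
    hw.1.aemeasurable.ennreal_ofReal.restrict
    (Eventually.of_forall fun _ => ENNReal.ofReal_lt_top) _ hs]
  refine setIntegral_congr_ae hs (hw.2.mono fun x hx _ => ?_)
  simp [ENNReal.toReal_ofReal hx.le, mul_comm]

/-- Conditional expectations with respect to a weighted measure. -/
theorem condExp_mul_weight [IsFiniteMeasure μ] (hw : IsWeight μ w) {m : MeasurableSpace Ω}
    (hm : m ≤ mΩ) {g : Ω → ℝ} (hg : Integrable g (wMeasure μ w)) :
    μ[fun x => g x * w x | m] =ᵐ[μ] fun x => ((wMeasure μ w)[g | m]) x * (μ[w | m]) x := by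
  have := isFiniteMeasure_wMeasure hw.1
  have hint : Integrable (fun x => ((wMeasure μ w)[g | m]) x * w x) μ :=
    (integrable_wMeasure_iff hw).1 integrable_condExp
  have hpull := condExp_mul_of_stronglyMeasurable_left (m := m) (μ := μ)
    (stronglyMeasurable_condExp (m := m) (μ := wMeasure μ w) (f := g)) hint hw.1
  refine EventuallyEq.trans ?_ hpull
  -- On sets of `m`, `g * w` and `E^w(g) * w` have equal `μ`-integrals, both being `w dμ`-integrals;
  -- so their conditional expectations agree, and `hpull` takes out the `m`-measurable factor.
  refine (ae_eq_condExp_of_forall_setIntegral_eq hm hint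
    (fun s _ _ => integrable_condExp.integrableOn) (fun s hs _ => ?_)
    stronglyMeasurable_condExp.aestronglyMeasurable)
  rw [setIntegral_condExp hm ((integrable_wMeasure_iff hw).1 hg) hs,
    ← setIntegral_wMeasure hw _ (hm s hs), ← setIntegral_condExp hm hg hs,
    setIntegral_wMeasure hw _ (hm s hs)]
  rfl

theorem wNorm_eq (hw : Integrable w μ) {q : ℝ} (hq : 0 < q) (f : Ω → ℝ) :
    wNorm μ q w f = (∫⁻ x, ENNReal.ofReal (w x) * ‖f x‖ₑ ^ q ∂μ) ^ (1 / q) := by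
  rw [wNorm, eLpNorm_eq_lintegral_rpow_enorm_toReal (by simpa using hq) ENNReal.ofReal_ne_top,
    ENNReal.toReal_ofReal hq.le, lintegral_wMeasure hw]

theorem measurable_infProd {m : MeasurableSpace Ω} {f : ℕ → Ω → ℝ≥0∞}
    (hf : ∀ i, Measurable[m] (f i)) : Measurable[m] (fun x => infProd (fun i => f i x)) :=
  Measurable.limsup fun _ => Finset.measurable_fun_prod _ fun i _ => hf i

theorem aemeasurable_infProd {f : ℕ → Ω → ℝ≥0∞} (hf : ∀ i, AEMeasurable (f i) μ) :
    AEMeasurable (fun x => infProd (fun i => f i x)) μ := by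
  refine ⟨fun x => infProd (fun i => (hf i).mk (f i) x),
    measurable_infProd fun i => (hf i).measurable_mk, ?_⟩
  filter_upwards [ae_all_iff.2 fun i => (hf i).ae_eq_mk] with x hx
  simp only [hx]

theorem measurable_maximal (μ : Measure Ω) (ℱ : Filtration ℕ mΩ) (f : ℕ → Ω → ℝ) :
    Measurable (maximal μ ℱ f) :=
  Measurable.iSup fun n => measurable_infProd fun _ =>
    (stronglyMeasurable_condExp.mono (ℱ.le n)).measurable.enorm

theorem maximal_congr_ae (ℱ : Filtration ℕ mΩ) {f g : ℕ → Ω → ℝ} (h : ∀ i, f i =ᵐ[μ] g i) :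
    maximal μ ℱ f =ᵐ[μ] maximal μ ℱ g := by
  have : ∀ᵐ x ∂μ, ∀ i n, (μ[f i | ℱ n]) x = (μ[g i | ℱ n]) x :=
    ae_all_iff.2 fun i => ae_all_iff.2 fun n => condExp_congr_ae (h i)
  filter_upwards [this] with x hx
  simp only [maximal, hx]

variable {p : ℕ → ℝ} {ω : ℕ → Ω → ℝ} {i : ℕ}

theorem IsWeight.dualWeight (hω : IsWeight μ (ω i))
    (hσ : Integrable (dualWeight p ω i) μ) : IsWeight μ (dualWeight p ω i) :=
  ⟨hσ, hω.2.mono fun _ hx => Real.rpow_pos_of_pos hx _⟩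

/-- This is `ω σ^p = σ`, from the exponent identity `1 - p / (p - 1) = -1 / (p - 1)`. -/
theorem weight_mul_rpow_dualWeight (hp : 1 < p i) {x : Ω} (hx : 0 < ω i x) (g : ℝ) :
    ENNReal.ofReal (ω i x) * ‖g * dualWeight p ω i x‖ₑ ^ p i =
      ENNReal.ofReal (dualWeight p ω i x) * ‖g‖ₑ ^ p i := by
  have hp0 : 0 < p i := by linarith
  have hp1 : p i - 1 ≠ 0 := by linarith
  have hσ : 0 < dualWeight p ω i x := Real.rpow_pos_of_pos hx _
  rw [enorm_mul, ENNReal.mul_rpow_of_nonneg _ _ hp0.le, Real.enorm_of_nonneg hσ.le,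
    ENNReal.ofReal_rpow_of_pos hσ, mul_left_comm, ← ENNReal.ofReal_mul hx.le, mul_comm]
  congr 2
  rw [dualWeight, ← Real.rpow_mul hx.le]
  nth_rw 1 [← Real.rpow_one (ω i x)]
  rw [← Real.rpow_add hx]
  congr 1
  field_simp
  ring

theorem wNorm_mul_dualWeight (hp : 1 < p i) (hω : IsWeight μ (ω i))
    (hσ : Integrable (dualWeight p ω i) μ) (g : Ω → ℝ) :
    wNorm μ (p i) (ω i) (fun x => g x * dualWeight p ω i x) =
      wNorm μ (p i) (dualWeight p ω i) g := by
  rw [wNorm_eq hω.1 (by linarith), wNorm_eq hσ (by linarith)]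
  congr 1
  exact lintegral_congr_ae (hω.2.mono fun x hx => weight_mul_rpow_dualWeight hp hx _)

theorem memWLp_mul_dualWeight (hp : 1 < p i) (hω : IsWeight μ (ω i))
    (hσ : Integrable (dualWeight p ω i) μ) {g : Ω → ℝ}
    (hg : MemWLp μ (p i) (dualWeight p ω i) g) :
    MemWLp μ (p i) (ω i) (fun x => g x * dualWeight p ω i x) := by
  refine ⟨?_, (wNorm_mul_dualWeight hp hω hσ g).trans_lt hg.2⟩
  exact ((hg.1.mono_ac (hω.dualWeight hσ).absolutelyContinuous).mul
    hσ.aestronglyMeasurable).mono_ac (wMeasure_absolutelyContinuous _ _)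

theorem div_mul_dualWeight_ae_eq (hω : IsWeight μ (ω i)) (f : Ω → ℝ) :
    (fun x => f x / dualWeight p ω i x * dualWeight p ω i x) =ᵐ[μ] f :=
  hω.2.mono fun _ hx => div_mul_cancel₀ _ (Real.rpow_pos_of_pos hx _).ne'

theorem wNorm_div_dualWeight (hp : 1 < p i) (hω : IsWeight μ (ω i))
    (hσ : Integrable (dualWeight p ω i) μ) (f : Ω → ℝ) :
    wNorm μ (p i) (dualWeight p ω i) (fun x => f x / dualWeight p ω i x) =
      wNorm μ (p i) (ω i) f := by
  rw [← wNorm_mul_dualWeight hp hω hσ]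
  exact eLpNorm_congr_ae
    ((wMeasure_absolutelyContinuous _ _).ae_eq (div_mul_dualWeight_ae_eq hω f))

theorem memWLp_div_dualWeight (hp : 1 < p i) (hω : IsWeight μ (ω i))
    (hσ : Integrable (dualWeight p ω i) μ) {f : Ω → ℝ} (hf : MemWLp μ (p i) (ω i) f) :
    MemWLp μ (p i) (dualWeight p ω i) (fun x => f x / dualWeight p ω i x) := by
  refine ⟨?_, (wNorm_div_dualWeight hp hω hσ f).trans_lt hf.2⟩
  exact ((hf.1.mono_ac hω.absolutelyContinuous).aemeasurable.div
    hσ.aemeasurable).aestronglyMeasurable.mono_ac (wMeasure_absolutelyContinuous _ _)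

theorem strongType_iff_dualStrongType (ℱ : Filtration ℕ mΩ) (p₀ : ℝ) (v : Ω → ℝ)
    (hp : ∀ i, 1 < p i) (hω : ∀ i, IsWeight μ (ω i))
    (hσ : ∀ i, Integrable (dualWeight p ω i) μ) :
    StrongType μ ℱ p p₀ v ω ↔ DualStrongType μ ℱ p p₀ v ω := by
  constructor
  · rintro ⟨C, hC, h⟩
    refine ⟨C, hC, fun g hg hconv => ?_⟩
    simp_rw [← fun i => wNorm_mul_dualWeight (hp i) (hω i) (hσ i) (g i)] at hconv ⊢
    exact h _ (fun i => memWLp_mul_dualWeight (hp i) (hω i) (hσ i) (hg i)) hconv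
  · rintro ⟨C, hC, h⟩
    refine ⟨C, hC, fun f hf hconv => ?_⟩
    simp_rw [← fun i => wNorm_div_dualWeight (hp i) (hω i) (hσ i) (f i)] at hconv ⊢
    refine le_of_eq_of_le (eLpNorm_congr_ae ((wMeasure_absolutelyContinuous _ _).ae_eq ?_))
      (h _ (fun i => memWLp_div_dualWeight (hp i) (hω i) (hσ i) (hf i)) hconv)
    exact maximal_congr_ae ℱ fun i => (div_mul_dualWeight_ae_eq (hω i) (f i)).symm

theorem eLpNorm_wMeasure_ennreal (hw : Integrable w μ) {q : ℝ} (hq : 0 < q) (F : Ω → ℝ≥0∞) :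
    eLpNorm F (ENNReal.ofReal q) (wMeasure μ w) =
      (∫⁻ x, F x ^ q * ENNReal.ofReal (w x) ∂μ) ^ (1 / q) := by
  rw [eLpNorm_eq_lintegral_rpow_enorm_toReal (by simpa using hq) ENNReal.ofReal_ne_top,
    ENNReal.toReal_ofReal hq.le, lintegral_wMeasure hw]
  simp_rw [enorm_eq_self, mul_comm]

theorem measurableSet_finiteSet {ℱ : Filtration ℕ mΩ} {τ : Ω → WithTop ℕ}
    (hτ : IsStoppingTime ℱ τ) : MeasurableSet (finiteSet τ) := by
  have : finiteSet τ = ⋃ n : ℕ, {x | τ x ≤ n} := by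
    ext x
    simp only [finiteSet, Set.mem_ofPred_eq, Set.mem_iUnion]
    constructor
    · intro h
      lift τ x to ℕ using h.ne with k
      exact ⟨k, le_rfl⟩
    · rintro ⟨n, hn⟩
      exact hn.trans_lt (WithTop.coe_lt_top n)
  rw [this]
  exact MeasurableSet.iUnion fun n => ℱ.le n _ (hτ n)

theorem wNorm_indicator_one (hw : Integrable w μ) {q : ℝ} (hq : 0 < q) {B : Set Ω}
    (hB : MeasurableSet B) :
    wNorm μ q w (B.indicator 1) = wMass μ w B ^ (1 / q) := by
  rw [wNorm_eq hw hq, wMass, ← lintegral_indicator hB]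
  congr 2
  ext x
  by_cases hx : x ∈ B <;> simp [hx, hq]

theorem wMass_ne_top (hw : Integrable w μ) (B : Set Ω) : wMass μ w B ≠ ∞ :=
  ne_top_of_le_ne_top hw.lintegral_lt_top.ne (setLIntegral_le_lintegral _ _)

theorem wMass_univ_ne_zero [NeZero μ] (hw : IsWeight μ w) : wMass μ w Set.univ ≠ 0 := by
  rw [wMass, setLIntegral_univ, Ne, lintegral_eq_zero_iff' hw.1.aemeasurable.ennreal_ofReal]
  intro h
  have : ∀ᵐ x ∂μ, False := by
    filter_upwards [h, hw.2] with x hx hx'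
    exact (ENNReal.ofReal_pos.2 hx').ne' hx
  exact NeZero.ne μ (by simpa using this)

theorem prodConverges_wMass_univ (hp : ∀ i, 1 < p i) (hω : ∀ i, IsWeight μ (ω i))
    (hσ : ∀ i, Integrable (dualWeight p ω i) μ)
    (h : ProdConverges (fun i => wNorm μ (p i) (ω i) (dualWeight p ω i))) :
    ProdConverges (fun i => wMass μ (dualWeight p ω i) Set.univ ^ (1 / p i)) := by
  convert h using 2 with i
  rw [← wNorm_indicator_one (hσ i) (by linarith [hp i]) MeasurableSet.univ,
    ← wNorm_mul_dualWeight (hp i) (hω i) (hσ i)]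
  simp

/-- The strong-type bound is tested on `g_i = χ_{τ < ∞}`, and the constant is kept. -/
theorem sawyerCondition_of_dualStrongType [IsProbabilityMeasure μ] {ℱ : Filtration ℕ mΩ}
    {p₀ : ℝ} {v : Ω → ℝ} (hp : ∀ i, 1 < p i) (hp₀ : 0 < p₀) (hv : IsWeight μ v)
    (hω : ∀ i, IsWeight μ (ω i)) (hσ : ∀ i, Integrable (dualWeight p ω i) μ)
    (hσ_norm : ProdConverges (fun i => wNorm μ (p i) (ω i) (dualWeight p ω i)))
    (h : DualStrongType μ ℱ p p₀ v ω) : SawyerCondition μ ℱ p p₀ v ω := by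
  obtain ⟨C, hC, h⟩ := h
  refine ⟨C, hC, fun τ hτ => ?_⟩
  have hB := measurableSet_finiteSet hτ
  set B := finiteSet τ
  have hnorm : ∀ i, wNorm μ (p i) (dualWeight p ω i) (B.indicator 1) =
      wMass μ (dualWeight p ω i) B ^ (1 / p i) := fun i =>
    wNorm_indicator_one (hσ i) (by linarith [hp i]) hB
  have hp' : ∀ i, 0 < 1 / p i := fun i => one_div_pos.2 (by linarith [hp i])
  -- Comparison with the product over the whole space, whose factors are positive and finite.
  have hconv : ProdConverges (fun i => wMass μ (dualWeight p ω i) B ^ (1 / p i)) := by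
    refine (prodConverges_wMass_univ hp hω hσ hσ_norm).of_le (fun i => ?_) (fun i => ?_)
      fun i => ENNReal.rpow_ne_top_of_nonneg (hp' i).le (wMass_ne_top (hσ i) _)
    · have := (hp' i).le
      gcongr
      exact lintegral_mono_set (Set.subset_univ B)
    · simp [wMass_univ_ne_zero ((hω i).dualWeight (hσ i)), wMass_ne_top (hσ i)]
  have hmain := h (fun _ => B.indicator 1) (fun i => ?_) (by simpa only [hnorm] using hconv)
  · simp only [hnorm, eLpNorm_wMeasure_ennreal hv.1 hp₀] at hmain
    refine le_trans ?_ hmain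
    have hind : (fun i => B.indicator (dualWeight p ω i)) =
        fun i x => (B.indicator 1 : Ω → ℝ) x * dualWeight p ω i x := by
      ext i x
      by_cases hx : x ∈ B <;> simp [hx]
    rw [hind]
    gcongr
    exact Measure.restrict_le_self
  · refine ⟨(stronglyMeasurable_one.indicator hB).aestronglyMeasurable, ?_⟩
    refine (hnorm i).trans_lt ?_
    exact (ENNReal.rpow_ne_top_of_nonneg (hp' i).le (wMass_ne_top (hσ i) _)).lt_top

end GenDoob

/-! ### From the testing condition to the strong-type estimate -/

namespace GenDoob

/-- Dyadic comparison of a power with the sum over the levels below it. -/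
theorem exists_tsum_zpow_lt_le {r : ℝ} (hr : 0 < r) :
    ∃ c : ℝ≥0∞, c ≠ ∞ ∧ ∀ x : ℝ≥0∞, x ≠ ∞ →
      ∑' k : ℤ, {y : ℝ≥0∞ | (2 : ℝ≥0∞) ^ k < y}.indicator (fun _ => ((2 : ℝ≥0∞) ^ (k + 1)) ^ r) x
        ≤ c * x ^ r := by
  have h20 : (2 : ℝ≥0∞) ≠ 0 := two_ne_zero
  have h2t : (2 : ℝ≥0∞) ≠ ∞ := ENNReal.ofNat_ne_top
  have hq : ((2 : ℝ≥0∞)⁻¹ ^ r) < 1 := ENNReal.rpow_lt_one (ENNReal.inv_lt_one.2 ENNReal.one_lt_two) hr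
  refine ⟨2 ^ r * (1 - (2 : ℝ≥0∞)⁻¹ ^ r)⁻¹, ENNReal.mul_ne_top
    (ENNReal.rpow_ne_top_of_nonneg hr.le h2t)
    (ENNReal.inv_ne_top.2 (tsub_pos_of_lt hq).ne'), fun x hx => ?_⟩
  rcases eq_or_ne x 0 with rfl | hx0
  · simp
  -- With `2^K < x ≤ 2^{K+1}` only the levels `k = K - j`, `j ≥ 0`, contribute, and they form a
  -- geometric series of ratio `2^{-r}`.
  obtain ⟨K, hK1, hK2⟩ := ENNReal.exists_mem_Ioc_zpow hx0 hx ENNReal.one_lt_two h2t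
  have hsupp : Function.support (fun k : ℤ =>
      {y : ℝ≥0∞ | (2 : ℝ≥0∞) ^ k < y}.indicator (fun _ => ((2 : ℝ≥0∞) ^ (k + 1)) ^ r) x) ⊆
      Set.range (fun j : ℕ => K - j) := by
    intro k hk
    have hkx : x ∈ {y : ℝ≥0∞ | (2 : ℝ≥0∞) ^ k < y} := Set.mem_of_indicator_ne_zero hk
    have hkx : (2 : ℝ≥0∞) ^ k < x := hkx
    have hkK : k < K + 1 := by
      by_contra! hcon
      exact absurd (hkx.trans_le hK2) (not_lt.2 (ENNReal.zpow_le_of_le one_le_two hcon))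
    exact ⟨(K - k).toNat, by dsimp only; lia⟩
  have hinj : Function.Injective (fun j : ℕ => K - j) := fun a b hab => by
    dsimp only at hab; lia
  rw [← hinj.tsum_eq hsupp]
  calc _ ≤ ∑' j : ℕ, 2 ^ r * x ^ r * ((2 : ℝ≥0∞)⁻¹ ^ r) ^ j := by
        refine ENNReal.tsum_le_tsum fun j => (Set.indicator_le_self _ _ _).trans ?_
        have hz : (2 : ℝ≥0∞) ^ (K - j + 1) = 2 * 2 ^ K * (2⁻¹) ^ j := by
          rw [sub_add_eq_add_sub, sub_eq_add_neg, ENNReal.zpow_add h20 h2t,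
            ENNReal.zpow_add h20 h2t, zpow_one, mul_comm (2 ^ K) (2 : ℝ≥0∞), ENNReal.zpow_neg, zpow_natCast,
            ENNReal.inv_pow]
        rw [hz, ENNReal.mul_rpow_of_nonneg _ _ hr.le, ENNReal.mul_rpow_of_nonneg _ _ hr.le,
          ← ENNReal.rpow_natCast, ← ENNReal.rpow_natCast, ← ENNReal.rpow_mul, ← ENNReal.rpow_mul,
          mul_comm r]
        gcongr
    _ = _ := by rw [ENNReal.tsum_mul_left, ENNReal.tsum_geometric]; ring

variable {Ω : Type*} {mΩ : MeasurableSpace Ω} {μ : Measure Ω} {w : Ω → ℝ}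

theorem abs_condExp_le_condExp {m : MeasurableSpace Ω} {f F : Ω → ℝ} (hf : Integrable f μ)
    (hF : Integrable F μ) (h : ∀ᵐ x ∂μ, |f x| ≤ F x) :
    ∀ᵐ x ∂μ, |(μ[f | m]) x| ≤ (μ[F | m]) x := by
  have h1 := condExp_mono (m := m) hf hF (h.mono fun x hx => (le_abs_self _).trans hx)
  have h2 := condExp_mono (m := m) hf.neg hF (h.mono fun x hx => (neg_le_abs _).trans hx)
  filter_upwards [h1, h2, condExp_neg f m] with x h1 h2 h3
  rw [h3] at h2
  exact abs_le'.2 ⟨h1, h2⟩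

theorem enorm_condExp_mul_weight_le [IsFiniteMeasure μ] (hw : IsWeight μ w)
    {m : MeasurableSpace Ω} (hm : m ≤ mΩ) {g : Ω → ℝ} (hg : Integrable g (wMeasure μ w)) :
    ∀ᵐ x ∂μ, ‖(μ[fun x => g x * w x | m]) x‖ₑ ≤
      ENNReal.ofReal (((wMeasure μ w)[fun y => |g y| | m]) x) * ‖(μ[w | m]) x‖ₑ := by
  have habs := abs_condExp_le_condExp (m := m) ((integrable_wMeasure_iff hw).1 hg)
    ((integrable_wMeasure_iff hw).1 hg.abs)
    (hw.2.mono fun x hx => by rw [abs_mul, abs_of_pos hx])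
  filter_upwards [habs, condExp_mul_weight hw hm hg.abs,
    condExp_nonneg (m := m) (hw.2.mono fun x hx => hx.le)] with x h1 h2 h3
  rw [Real.enorm_eq_ofReal_abs, Real.enorm_of_nonneg h3, ← ENNReal.ofReal_mul' h3, ← h2]
  exact ENNReal.ofReal_le_ofReal h1

/-- Since `{τ ≤ n}` lies in `ℱ n`, on it `E_n(w)` equals `E_n(w χ_{τ ≤ n})`, and `{τ ≤ n} ⊆ {τ <
∞}`. -/
theorem enorm_condExp_le_enorm_condExp_indicator_finiteSet [IsFiniteMeasure μ] (hw : IsWeight μ w)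
    {ℱ : Filtration ℕ mΩ} {τ : Ω → WithTop ℕ} (hτ : IsStoppingTime ℱ τ) (n : ℕ) :
    ∀ᵐ x ∂μ, τ x ≤ n →
      ‖(μ[w | ℱ n]) x‖ₑ ≤ ‖(μ[(finiteSet τ).indicator w | ℱ n]) x‖ₑ := by
  have hsub : {x | τ x ≤ n} ⊆ finiteSet τ := fun x hx =>
    lt_of_le_of_lt hx (WithTop.coe_lt_top n)
  have hmono := condExp_mono (m := ℱ n) (hw.1.indicator (ℱ.le n _ (hτ n)))
    (hw.1.indicator (measurableSet_finiteSet hτ)) (hw.2.mono fun x hx =>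
      (Set.indicator_le_indicator_apply_of_subset hsub hx.le))
  filter_upwards [hmono, condExp_indicator hw.1 (hτ n),
    condExp_nonneg (m := ℱ n) (hw.2.mono fun x hx => hx.le)] with x h1 h2 h3 hx
  rw [h2, Set.indicator_of_mem (by exact hx)] at h1
  rw [Real.enorm_of_nonneg h3, Real.enorm_of_nonneg (h3.trans h1)]
  exact ENNReal.ofReal_le_ofReal h1

theorem lintegral_ofReal_condExp [IsFiniteMeasure μ] (hw : IsWeight μ w) {m : MeasurableSpace Ω}
    (hm : m ≤ mΩ) : ∫⁻ x, ENNReal.ofReal ((μ[w | m]) x) ∂μ = wMass μ w Set.univ := by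
  have h0 : 0 ≤ᵐ[μ] w := hw.2.mono fun x hx => hx.le
  rw [wMass, setLIntegral_univ, ← ofReal_integral_eq_lintegral_ofReal hw.1 h0,
    ← ofReal_integral_eq_lintegral_ofReal integrable_condExp (condExp_nonneg h0),
    integral_condExp hm]

/-- The product `∏ E^{σ_i}(|g_i| | ℱ_n)` of conditional expectations with respect to the dual
weights. -/
noncomputable def weightedCondProd (μ : Measure Ω) (ℱ : Filtration ℕ mΩ) (p : ℕ → ℝ) (ω g : ℕ → Ω → ℝ) (n : ℕ)
    (x : Ω) : ℝ≥0∞ :=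
  infProd fun i => ENNReal.ofReal (((wMeasure μ (dualWeight p ω i))[fun y => |g i y| | ℱ n]) x)

variable {p : ℕ → ℝ} {p₀ : ℝ} {ω g : ℕ → Ω → ℝ} {ℱ : Filtration ℕ mΩ} {v : Ω → ℝ}

theorem measurable_weightedCondProd (n : ℕ) : Measurable[ℱ n] (weightedCondProd μ ℱ p ω g n) :=
  measurable_infProd fun _ => stronglyMeasurable_condExp.measurable.ennreal_ofReal

/-- The factors are `1 + 1 / (p_i - 1)`. As `1 / p_i → 0`, all but finitely many `p_i` exceed `2`,
where `1 / (p_i - 1) ≤ 2 / p_i`. -/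
theorem prodConverges_conjExponent (hp : ∀ i, 1 < p i) (hsum : Summable fun i => 1 / p i) :
    ProdConverges (fun i => ENNReal.ofReal (p i / (p i - 1))) := by
  have hs : Summable fun i => 1 / (p i - 1) := by
    have hev : ∀ᶠ i in cofinite, 1 / p i < 1 / 2 :=
      hsum.tendsto_cofinite_zero.eventually_lt_const (by norm_num)
    refine (hsum.mul_left 2).of_norm_bounded_eventually (hev.mono fun i hi => ?_)
    have h1 := hp i
    have h2 : 2 < p i := by
      rwa [one_div_lt_one_div (by linarith) two_pos] at hi
    rw [Real.norm_of_nonneg (by rw [one_div_nonneg]; linarith), mul_one_div,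
      div_le_div_iff₀ (by linarith) (by linarith)]
    linarith
  convert prodConverges_one_add hs.tsum_ofReal_ne_top using 2 with i
  have : 0 < p i - 1 := by linarith [hp i]
  rw [← ENNReal.ofReal_one, ← ENNReal.ofReal_add zero_le_one (by positivity)]
  congr 1
  field_simp
  ring

theorem ae_prodConverges_dualWeight [IsProbabilityMeasure μ] (hp : ∀ i, 1 < p i)
    (hsum : Summable fun i => 1 / p i) (hω : ∀ i, IsWeight μ (ω i))
    (hσ : ∀ i, Integrable (dualWeight p ω i) μ)
    (hσ_norm : ProdConverges (fun i => wNorm μ (p i) (ω i) (dualWeight p ω i))) :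
    ∀ᵐ x ∂μ, ProdConverges (fun i => ENNReal.ofReal (dualWeight p ω i x) ^ (1 / p i)) :=
  ae_prodConverges_rpow (fun i => (hσ i).aemeasurable.ennreal_ofReal)
    (fun i => by rw [wMass, setLIntegral_univ]) (fun i => wMass_ne_top (hσ i) Set.univ)
    (fun i => one_div_pos.2 (by linarith [hp i]))
    (fun i => (div_le_one (by linarith [hp i])).2 (hp i).le) hsum
    (prodConverges_wMass_univ hp hω hσ hσ_norm)

/-- Split `E(σ_i)` into its powers `1 / p_i` and `1 / p_i'`: the first product converges because the
masses of the `σ_i` control it, the second by assumption. -/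
theorem ae_infProd_condExp_ne_top [IsProbabilityMeasure μ] (hp : ∀ i, 1 < p i)
    (hsum : Summable fun i => 1 / p i) (hω : ∀ i, IsWeight μ (ω i))
    (hσ : ∀ i, Integrable (dualWeight p ω i) μ)
    (hσ_norm : ProdConverges (fun i => wNorm μ (p i) (ω i) (dualWeight p ω i)))
    {m : MeasurableSpace Ω} (hm : m ≤ mΩ)
    (hσ_cond : ∀ᵐ x ∂μ, ProdConverges (fun i =>
      ENNReal.ofReal ((μ[dualWeight p ω i | m]) x) ^ (1 / (p i).conjExponent))) :
    ∀ᵐ x ∂μ, infProd (fun i => ‖(μ[dualWeight p ω i | m]) x‖ₑ) ≠ ∞ := by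
  have hconv := ae_prodConverges_rpow (μ := μ)
    (Y := fun i x => ENNReal.ofReal ((μ[dualWeight p ω i | m]) x))
    (fun i => (stronglyMeasurable_condExp.mono hm).measurable.ennreal_ofReal.aemeasurable)
    (fun i => (lintegral_ofReal_condExp ((hω i).dualWeight (hσ i)) hm).le)
    (fun i => wMass_ne_top (hσ i) Set.univ)
    (fun i => one_div_pos.2 (by linarith [hp i]))
    (fun i => (div_le_one (by linarith [hp i])).2 (hp i).le) hsum
    (prodConverges_wMass_univ hp hω hσ hσ_norm)
  have hnonneg : ∀ᵐ x ∂μ, ∀ i, 0 ≤ (μ[dualWeight p ω i | m]) x := ae_all_iff.2 fun i =>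
    condExp_nonneg (((hω i).dualWeight (hσ i)).2.mono fun x hx => hx.le)
  filter_upwards [hconv, hσ_cond, hnonneg] with x h1 h2 h3
  convert (h1.mul h2).infProd_ne_top using 3 with i
  have hconj := Real.HolderConjugate.conjExponent (hp i)
  rw [← ENNReal.rpow_add_of_nonneg _ _ (one_div_pos.2 hconj.pos).le
    (one_div_pos.2 hconj.symm.pos).le, one_div, one_div, hconj.inv_add_inv_eq_one,
    ENNReal.rpow_one, Real.enorm_of_nonneg (h3 i)]

/-- The maximal estimate for products of conditional expectations with respect to the dual
weights: it combines Doob's inequality for each weight with Hölder's inequality. -/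
theorem lintegral_iSup_weightedCondProd_le [IsProbabilityMeasure μ] (hp : ∀ i, 1 < p i)
    (hp₀ : 0 < p₀) (hsum : HasSum (fun i => 1 / p i) (1 / p₀)) (hω : ∀ i, IsWeight μ (ω i))
    (hσ : ∀ i, Integrable (dualWeight p ω i) μ)
    (hσ_norm : ProdConverges (fun i => wNorm μ (p i) (ω i) (dualWeight p ω i)))
    (hσ_pos : ∀ᵐ x ∂μ, 0 < infProd (fun i =>
      ENNReal.ofReal (dualWeight p ω i x) ^ (1 / p i)))
    (hg : ∀ i, MemWLp μ (p i) (dualWeight p ω i) (g i))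
    (hconv : ProdConverges (fun i => wNorm μ (p i) (dualWeight p ω i) (g i))) :
    (∀ᵐ x ∂μ, (⨆ n, weightedCondProd μ ℱ p ω g n x) ≠ ∞) ∧
    ∫⁻ x, (⨆ n, weightedCondProd μ ℱ p ω g n x) ^ p₀ *
        infProd (fun i => ENNReal.ofReal (dualWeight p ω i x) ^ (p₀ / p i)) ∂μ ≤
      (infProd (fun i => ENNReal.ofReal (p i / (p i - 1))) *
        infProd (fun i => wNorm μ (p i) (dualWeight p ω i) (g i))) ^ p₀ := by
  have hp0 : ∀ i, 0 < p i := fun i => by linarith [hp i]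
  have hp0' : ∀ i, 0 < 1 / p i := fun i => one_div_pos.2 (hp0 i)
  set M : ℕ → Ω → ℝ≥0∞ := fun i x =>
    ⨆ n, ENNReal.ofReal (((wMeasure μ (dualWeight p ω i))[fun y => |g i y| | ℱ n]) x) with hM
  -- Chosen so that Doob's inequality for `σ_i dμ` bounds `∫ Y_i` by `N_i`, while `Y_i ^ (1 / p_i) =
  -- M_i σ_i ^ (1 / p_i)`.
  set Y : ℕ → Ω → ℝ≥0∞ := fun i x => ENNReal.ofReal (dualWeight p ω i x) * M i x ^ p i with hYdef
  set N : ℕ → ℝ≥0∞ := fun i => ENNReal.ofReal (p i / (p i - 1)) ^ p i *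
    wNorm μ (p i) (dualWeight p ω i) (g i) ^ p i with hNdef
  have hMmeas : ∀ i, Measurable (M i) := fun i => Measurable.iSup fun n =>
    (stronglyMeasurable_condExp.mono (ℱ.le n)).measurable.ennreal_ofReal
  have hY : ∀ i, AEMeasurable (Y i) μ := fun i =>
    (hσ i).aemeasurable.ennreal_ofReal.mul ((hMmeas i).pow_const _).aemeasurable
  have hYN : ∀ i, ∫⁻ x, Y i x ∂μ ≤ N i := fun i => by
    have := isFiniteMeasure_wMeasure (hσ i)
    have hgi : Integrable (g i) (wMeasure μ (dualWeight p ω i)) :=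
      (hg i).integrable (by simpa using (hp i).le)
    have hdoob := lintegral_iSup_condExp_rpow_le ℱ hgi.abs
      (Eventually.of_forall fun x => abs_nonneg _) (hp i)
    rw [lintegral_wMeasure (hσ i), lintegral_wMeasure (hσ i)] at hdoob
    rw [hNdef]
    dsimp only
    rw [wNorm_eq (hσ i) (hp0 i), ← ENNReal.rpow_mul, one_div_mul_cancel (hp0 i).ne',
      ENNReal.rpow_one]
    simpa only [Real.enorm_eq_ofReal_abs] using hdoob
  have hN : ∀ i, N i ≠ ∞ := fun i => ENNReal.mul_ne_top
    (ENNReal.rpow_ne_top_of_nonneg (hp0 i).le ENNReal.ofReal_ne_top)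
    (ENNReal.rpow_ne_top_of_nonneg (hp0 i).le (hg i).2.ne)
  have hNpow : ∀ i, N i ^ (1 / p i) =
      ENNReal.ofReal (p i / (p i - 1)) * wNorm μ (p i) (dualWeight p ω i) (g i) := fun i => by
    rw [hNdef]
    dsimp only
    rw [← ENNReal.mul_rpow_of_nonneg _ _ (hp0 i).le, ← ENNReal.rpow_mul,
      mul_one_div_cancel (hp0 i).ne', ENNReal.rpow_one]
  have hconj := prodConverges_conjExponent hp hsum.summable
  have hNconv : ProdConverges (fun i => N i ^ (1 / p i)) := by
    simpa only [hNpow] using hconj.mul hconv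
  have hYconv := ae_prodConverges_rpow hY hYN hN hp0'
    (fun i => (div_le_one (hp0 i)).2 (hp i).le) hsum.summable hNconv
  have hYpow : ∀ i x, Y i x ^ (1 / p i) =
      M i x * ENNReal.ofReal (dualWeight p ω i x) ^ (1 / p i) := fun i x => by
    rw [hYdef]
    dsimp only
    rw [ENNReal.mul_rpow_of_nonneg _ _ (hp0' i).le, ← ENNReal.rpow_mul,
      mul_one_div_cancel (hp0 i).ne', ENNReal.rpow_one, mul_comm]
  have hpt : ∀ᵐ x ∂μ, (⨆ n, weightedCondProd μ ℱ p ω g n x) *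
      infProd (fun i => ENNReal.ofReal (dualWeight p ω i x) ^ (1 / p i)) ≤
      infProd (fun i => Y i x ^ (1 / p i)) := by
    filter_upwards [ae_prodConverges_dualWeight hp hsum.summable hω hσ hσ_norm] with x hx
    rw [ENNReal.iSup_mul]
    refine iSup_le fun n => ?_
    refine (mul_le_mul_left (infProd_mono fun i => le_iSup (fun n => ENNReal.ofReal
      (((wMeasure μ (dualWeight p ω i))[fun y => |g i y| | ℱ n]) x)) n) _).trans ?_
    -- The product of the `M_i` need not converge; convergence of the `σ_i` product alone justifies
    -- `limsup · liminf ≤ limsup` of the product.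
    rw [← hx.tendsto.liminf_eq]
    refine ENNReal.le_limsup_mul.trans (le_of_eq ?_)
    simp only [infProd, hYpow, Finset.prod_mul_distrib]
    rfl
  constructor
  · filter_upwards [hpt, hYconv, hσ_pos] with x h1 h2 h3 htop
    rw [htop, ENNReal.top_mul h3.ne', top_le_iff] at h1
    exact h2.infProd_ne_top h1
  · calc _ ≤ ∫⁻ x, infProd (fun i => Y i x ^ (1 / p i)) ^ p₀ ∂μ := by
          refine lintegral_mono_ae (hpt.mono fun x hx => ?_)
          simp_rw [fun i => show p₀ / p i = 1 / p i * p₀ by ring, ENNReal.rpow_mul]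
          rw [infProd_rpow _ hp₀, ← ENNReal.mul_rpow_of_nonneg _ _ hp₀.le]
          gcongr
      _ ≤ infProd (fun i => N i ^ (1 / p i)) ^ p₀ :=
          lintegral_infProd_rpow_le hp₀ hY hYN hp0' hsum hYconv
      _ = _ := by simp only [hNpow, hconj.infProd_mul hconv]

/-- Away from a null set, the maximal function is bounded by the suprema of products of weighted
conditional expectations and conditional expectations of the dual weights. -/
theorem ae_maximal_mul_dualWeight_le [IsProbabilityMeasure μ] (hω : ∀ i, IsWeight μ (ω i))
    (hσ : ∀ i, Integrable (dualWeight p ω i) μ)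
    (hg : ∀ i, Integrable (g i) (wMeasure μ (dualWeight p ω i)))
    (hfin : ∀ᵐ x ∂μ, ∀ n, weightedCondProd μ ℱ p ω g n x ≠ ∞)
    (hD : ∀ n, ∀ᵐ x ∂μ, infProd (fun i => ‖(μ[dualWeight p ω i | ℱ n]) x‖ₑ) ≠ ∞) :
    ∀ᵐ x ∂μ, maximal μ ℱ (fun i x => g i x * dualWeight p ω i x) x ≤
      ⨆ n, weightedCondProd μ ℱ p ω g n x *
        infProd (fun i => ‖(μ[dualWeight p ω i | ℱ n]) x‖ₑ) := by
  have hle : ∀ᵐ x ∂μ, ∀ i n, ‖(μ[fun x => g i x * dualWeight p ω i x | ℱ n]) x‖ₑ ≤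
      ENNReal.ofReal (((wMeasure μ (dualWeight p ω i))[fun y => |g i y| | ℱ n]) x) *
        ‖(μ[dualWeight p ω i | ℱ n]) x‖ₑ := ae_all_iff.2 fun i => ae_all_iff.2 fun n =>
    enorm_condExp_mul_weight_le ((hω i).dualWeight (hσ i)) (ℱ.le n) (hg i)
  filter_upwards [hle, hfin, ae_all_iff.2 hD] with x h1 h2 h3
  refine iSup_mono fun n => (infProd_mono fun i => h1 i n).trans ?_
  simp only [infProd, Finset.prod_mul_distrib]
  -- Finiteness of both upper limits excludes the form `0 · ∞`.
  exact ENNReal.limsup_mul_le' (Or.inr (h3 n)) (Or.inl (h2 n))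

theorem dualStrongType_of_sawyerCondition [IsProbabilityMeasure μ] (hp : ∀ i, 1 < p i)
    (hp₀ : 0 < p₀) (hsum : HasSum (fun i => 1 / p i) (1 / p₀)) (hv : IsWeight μ v)
    (hω : ∀ i, IsWeight μ (ω i)) (hσ : ∀ i, Integrable (dualWeight p ω i) μ)
    (hσ_norm : ProdConverges (fun i => wNorm μ (p i) (ω i) (dualWeight p ω i)))
    (hσ_cond : ∀ n, ∀ᵐ x ∂μ, ProdConverges (fun i =>
      ENNReal.ofReal ((μ[dualWeight p ω i | ℱ n]) x) ^ (1 / (p i).conjExponent)))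
    (hσ_pos : ∀ᵐ x ∂μ, 0 < infProd (fun i =>
      ENNReal.ofReal (dualWeight p ω i x) ^ (1 / p i)))
    (hRH : ReverseHolder μ ℱ p p₀ ω) (hS : SawyerCondition μ ℱ p p₀ v ω) :
    DualStrongType μ ℱ p p₀ v ω := by
  obtain ⟨C₁, -, hRH⟩ := hRH
  obtain ⟨C₂, -, hS⟩ := hS
  obtain ⟨c, hc, hsumle⟩ := exists_tsum_zpow_lt_le hp₀
  have hp₀' : 0 < 1 / p₀ := one_div_pos.2 hp₀
  have hKtop := (prodConverges_conjExponent hp hsum.summable).infProd_ne_top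
  set K := infProd (fun i => ENNReal.ofReal (p i / (p i - 1)))
  set W : Ω → ℝ≥0∞ := fun x =>
    infProd (fun i => ENNReal.ofReal (dualWeight p ω i x) ^ (p₀ / p i)) with hW
  -- The testing condition raised to the power `p₀` has on its right exactly the product that the
  -- reverse Hölder condition bounds by `∫ W`.
  have htest : ∀ τ : Ω → WithTop ℕ, IsStoppingTime ℱ τ → ∫⁻ x in finiteSet τ,
      maximal μ ℱ (fun i => (finiteSet τ).indicator (dualWeight p ω i)) x ^ p₀
        * ENNReal.ofReal (v x) ∂μ ≤ C₂ ^ p₀ * C₁ * ∫⁻ x in finiteSet τ, W x ∂μ := by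
    intro τ hτ
    have h := ENNReal.rpow_le_rpow (hS τ hτ) hp₀.le
    rw [← ENNReal.rpow_mul, one_div_mul_cancel hp₀.ne', ENNReal.rpow_one,
      ENNReal.mul_rpow_of_nonneg _ _ hp₀.le, ← infProd_rpow _ hp₀] at h
    simp_rw [← ENNReal.rpow_mul, one_div_mul_eq_div] at h
    rw [mul_assoc]
    exact h.trans (by gcongr; exact hRH τ hτ)
  set A : ℝ≥0∞ := (C₂ ^ p₀ * C₁ * c) ^ (1 / p₀) * K with hA
  have hAtop : A ≠ ∞ := by
    refine ENNReal.mul_ne_top (ENNReal.rpow_ne_top_of_nonneg hp₀'.le ?_) hKtop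
    exact ENNReal.mul_ne_top (ENNReal.mul_ne_top
      (ENNReal.rpow_ne_top_of_nonneg hp₀.le ENNReal.coe_ne_top) ENNReal.coe_ne_top) hc
  -- The `+ 1` only ensures a positive constant.
  refine ⟨A.toNNReal + 1, by positivity, fun g hg hconv => ?_⟩
  obtain ⟨hHfin, hHint⟩ := lintegral_iSup_weightedCondProd_le (ℱ := ℱ) hp hp₀ hsum hω hσ hσ_norm
    hσ_pos hg hconv
  set h := weightedCondProd μ ℱ p ω g with hh
  set H : Ω → ℝ≥0∞ := fun x => ⨆ n, h n x with hH
  have hgint : ∀ i, Integrable (g i) (wMeasure μ (dualWeight p ω i)) := fun i => by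
    have := isFiniteMeasure_wMeasure (hσ i)
    exact (hg i).integrable (by simpa using (hp i).le)
  have hmax := ae_maximal_mul_dualWeight_le hω hσ hgint
    (hHfin.mono fun x hx n => ne_top_of_le_ne_top hx (le_iSup (fun n => h n x) n))
    (fun n => ae_infProd_condExp_ne_top hp hsum.summable hω hσ hσ_norm (ℱ.le n) (hσ_cond n))
  have hhmeas : ∀ n, Measurable[ℱ n] (h n) := fun n => measurable_weightedCondProd n
  set τ : ℤ → Ω → WithTop ℕ := fun k => hittingAfter h (Set.Ioi (2 ^ k)) 0 with hτdef
  have hτ : ∀ k, IsStoppingTime ℱ (τ k) := fun k =>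
    Adapted.isStoppingTime_hittingAfter hhmeas measurableSet_Ioi
  have hτle : ∀ k n x, (2 : ℝ≥0∞) ^ k < h n x → τ k x ≤ n := fun k n x hx =>
    hittingAfter_le_of_mem (Nat.zero_le n) hx
  have hB : ∀ k, finiteSet (τ k) = {x | (2 : ℝ≥0∞) ^ k < H x} := by
    intro k
    ext x
    simp only [finiteSet, Set.mem_ofPred_eq, lt_top_iff_ne_top, hτdef, Ne,
      hittingAfter_eq_top_iff, hH, lt_iSup_iff]
    simp
  have hBmeas := fun k => measurableSet_finiteSet (hτ k)
  set m : ℤ → Ω → ℝ≥0∞ := fun k =>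
    maximal μ ℱ (fun i => (finiteSet (τ k)).indicator (dualWeight p ω i)) with hm
  have hDm : ∀ᵐ x ∂μ, ∀ k n, (2 : ℝ≥0∞) ^ k < h n x →
      infProd (fun i => ‖(μ[dualWeight p ω i | ℱ n]) x‖ₑ) ≤ m k x := by
    have : ∀ᵐ x ∂μ, ∀ (k : ℤ) (n i : ℕ), τ k x ≤ n → ‖(μ[dualWeight p ω i | ℱ n]) x‖ₑ ≤
        ‖(μ[(finiteSet (τ k)).indicator (dualWeight p ω i) | ℱ n]) x‖ₑ :=
      ae_all_iff.2 fun k => ae_all_iff.2 fun n => ae_all_iff.2 fun i =>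
        enorm_condExp_le_enorm_condExp_indicator_finiteSet ((hω i).dualWeight (hσ i)) (hτ k) n
    filter_upwards [this] with x hx k n hkn
    exact le_iSup_of_le n (infProd_mono fun i => hx k n i (hτle k n x hkn))
  -- The dyadic level of `h n x` varies with `n`, so the supremum over `n` is bounded by the sum
  -- over all levels.
  have hpt : ∀ᵐ x ∂μ, maximal μ ℱ (fun i x => g i x * dualWeight p ω i x) x ^ p₀ *
      ENNReal.ofReal (v x) ≤ ∑' k : ℤ, ((2 : ℝ≥0∞) ^ (k + 1)) ^ p₀ *
        (finiteSet (τ k)).indicator (fun x => m k x ^ p₀ * ENNReal.ofReal (v x)) x := by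
    filter_upwards [hmax, hDm, hHfin] with x h1 h2 h3
    refine (mul_le_mul_left (ENNReal.rpow_le_rpow h1 hp₀.le) _).trans ?_
    have hsup := (ENNReal.orderIsoRpow p₀ hp₀).map_iSup (fun n => h n x *
      infProd (fun i => ‖(μ[dualWeight p ω i | ℱ n]) x‖ₑ))
    simp only [ENNReal.orderIsoRpow_apply] at hsup
    rw [hsup, ENNReal.iSup_mul]
    refine iSup_le fun n => ?_
    rcases eq_or_ne (h n x) 0 with h0 | h0
    · simp [h0, hp₀]
    obtain ⟨k, hk1, hk2⟩ := ENNReal.exists_mem_Ioc_zpow h0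
      (ne_top_of_le_ne_top h3 (le_iSup (fun n => h n x) n)) ENNReal.one_lt_two ENNReal.ofNat_ne_top
    refine le_trans ?_ (ENNReal.le_tsum k)
    have hxB : x ∈ finiteSet (τ k) :=
      lt_of_le_of_lt (hτle k n x hk1) (WithTop.coe_lt_top n)
    rw [Set.indicator_of_mem hxB, ENNReal.mul_rpow_of_nonneg _ _ hp₀.le, mul_assoc]
    gcongr
    exact h2 k n hk1
  have hint : ∫⁻ x, maximal μ ℱ (fun i x => g i x * dualWeight p ω i x) x ^ p₀ *
      ENNReal.ofReal (v x) ∂μ ≤ C₂ ^ p₀ * C₁ * c *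
        (K * infProd (fun i => wNorm μ (p i) (dualWeight p ω i) (g i))) ^ p₀ := by
    have hWmeas : AEMeasurable W μ :=
      aemeasurable_infProd fun i => (hσ i).aemeasurable.ennreal_ofReal.pow_const _
    have hmm : ∀ k, AEMeasurable (fun x => m k x ^ p₀ * ENNReal.ofReal (v x)) μ := fun k =>
      ((measurable_maximal μ ℱ _).pow_const _).aemeasurable.mul hv.1.aemeasurable.ennreal_ofReal
    calc _ ≤ ∫⁻ x, ∑' k : ℤ, ((2 : ℝ≥0∞) ^ (k + 1)) ^ p₀ *
            (finiteSet (τ k)).indicator (fun x => m k x ^ p₀ * ENNReal.ofReal (v x)) x ∂μ :=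
          lintegral_mono_ae hpt
      _ = ∑' k : ℤ, ((2 : ℝ≥0∞) ^ (k + 1)) ^ p₀ *
            ∫⁻ x in finiteSet (τ k), m k x ^ p₀ * ENNReal.ofReal (v x) ∂μ := by
          rw [lintegral_tsum fun k => ((hmm k).indicator (hBmeas k)).const_mul _]
          congr! 2 with k
          rw [lintegral_const_mul'' _ ((hmm k).indicator (hBmeas k)),
            lintegral_indicator (hBmeas k)]
      _ ≤ ∑' k : ℤ, ((2 : ℝ≥0∞) ^ (k + 1)) ^ p₀ *
            (C₂ ^ p₀ * C₁ * ∫⁻ x in finiteSet (τ k), W x ∂μ) := by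
          gcongr with k
          exact htest (τ k) (hτ k)
      -- The sets `{H > 2^k}` are nested, not disjoint; after exchanging sum and integral, the
      -- overlap costs only the factor `c`.
      _ = C₂ ^ p₀ * C₁ * ∫⁻ x, (∑' k : ℤ, {y : ℝ≥0∞ | (2 : ℝ≥0∞) ^ k < y}.indicator
            (fun _ => ((2 : ℝ≥0∞) ^ (k + 1)) ^ p₀) (H x)) * W x ∂μ := by
          simp_rw [← ENNReal.tsum_mul_right]
          have hterm : ∀ (k : ℤ) (x : Ω), {y : ℝ≥0∞ | (2 : ℝ≥0∞) ^ k < y}.indicator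
              (fun _ => ((2 : ℝ≥0∞) ^ (k + 1)) ^ p₀) (H x) * W x =
              ((2 : ℝ≥0∞) ^ (k + 1)) ^ p₀ * (finiteSet (τ k)).indicator W x := by
            intro k x
            rw [hB k]
            by_cases hx : (2 : ℝ≥0∞) ^ k < H x <;> simp [hx]
          simp_rw [hterm]
          rw [lintegral_tsum fun k => (hWmeas.indicator (hBmeas k)).const_mul _,
            ← ENNReal.tsum_mul_left]
          congr! 2 with k
          rw [lintegral_const_mul'' _ (hWmeas.indicator (hBmeas k)),
            lintegral_indicator (hBmeas k)]
          ring
      _ ≤ C₂ ^ p₀ * C₁ * ∫⁻ x, c * (H x ^ p₀ * W x) ∂μ := by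
          gcongr 1
          refine lintegral_mono_ae (hHfin.mono fun x hx => ?_)
          rw [← mul_assoc]
          gcongr
          exact hsumle _ hx
      _ ≤ _ := by
          rw [lintegral_const_mul' _ _ hc, ← mul_assoc]
          gcongr
  rw [eLpNorm_wMeasure_ennreal hv.1 hp₀]
  calc _ ≤ (C₂ ^ p₀ * C₁ * c *
        (K * infProd (fun i => wNorm μ (p i) (dualWeight p ω i) (g i))) ^ p₀) ^ (1 / p₀) := by
        gcongr
    _ = A * infProd (fun i => wNorm μ (p i) (dualWeight p ω i) (g i)) := by
        rw [ENNReal.mul_rpow_of_nonneg _ _ hp₀'.le, ← ENNReal.rpow_mul,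
          mul_one_div_cancel hp₀.ne', ENNReal.rpow_one, hA, ← mul_assoc]
    _ ≤ _ := by
        gcongr
        rw [ENNReal.coe_add, ENNReal.coe_toNNReal hAtop]
        exact le_self_add

end GenDoob

theorem theorem1p2 {Ω : Type*} {mΩ : MeasurableSpace Ω} (μ : Measure Ω) [IsProbabilityMeasure μ]
    [μ.IsComplete] (ℱ : Filtration ℕ mΩ) (hℱ : ⨆ n, ℱ n = mΩ)
    (p : ℕ → ℝ) (p₀ : ℝ) (hp : ∀ i, 1 < p i) (hp₀ : 0 < p₀)
    (hsum : HasSum (fun i => 1 / p i) (1 / p₀))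
    (v : Ω → ℝ) (hv : GenDoob.IsWeight μ v)
    (ω : ℕ → Ω → ℝ) (hω : ∀ i, GenDoob.IsWeight μ (ω i))
    (hσ : ∀ i, Integrable (GenDoob.dualWeight p ω i) μ)
    (hσ_norm : GenDoob.ProdConverges
      (fun i => GenDoob.wNorm μ (p i) (ω i) (GenDoob.dualWeight p ω i)))
    (hσ_cond : ∀ n, ∀ᵐ x ∂μ, GenDoob.ProdConverges (fun i =>
      ENNReal.ofReal ((μ[GenDoob.dualWeight p ω i | ℱ n]) x) ^ (1 / (p i).conjExponent)))
    (hσ_pos : ∀ᵐ x ∂μ, 0 < GenDoob.infProd (fun i =>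
      ENNReal.ofReal (GenDoob.dualWeight p ω i x) ^ (1 / p i)))
    (hRH : GenDoob.ReverseHolder μ ℱ p p₀ ω) :
    [GenDoob.StrongType μ ℱ p p₀ v ω,
     GenDoob.DualStrongType μ ℱ p p₀ v ω,
     GenDoob.SawyerCondition μ ℱ p p₀ v ω].TFAE := by
  tfae_have 1 ↔ 2 := GenDoob.strongType_iff_dualStrongType ℱ p₀ v hp hω hσ
  tfae_have 2 → 3 := GenDoob.sawyerCondition_of_dualStrongType hp hp₀ hv hω hσ hσ_norm
  tfae_have 3 → 2 := GenDoob.dualStrongType_of_sawyerCondition hp hp₀ hsum hv hω hσ hσ_norm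
    hσ_cond hσ_pos hRH
  tfae_finish
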